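/- **Setting (random-worlds method).** Fix a finite first-order vocabulary. The language $L^{\approx}$ consists of first-order formulas with equality, extended as follows. Proportion expressions are built from numbers, proportion terms $\|\varphi\|_X$ and conditional proportion terms $\|\varphi|\psi\|_X$ ($X$ a finite set of variables) by addition and multiplication. Comparisons $\zeta\approx_i\zeta'$ and $\zeta\preceq_i\zeta'$ of proportion expressions ($i\in\mathbb N$) are formulas, and formulas are closed under $\neg,\wedge,\forall$; $\varphi\Rightarrow\psi$ is shorthand for $\neg\varphi\vee\psi$. A *tolerance vector* is a sequence $\vec\tau=(\tau_0,\tau_1,\dots)$ of positive reals. In a world (a structure with a finite domain $\{1,\dots,N\}$), $\|\varphi\|_X$ is the fraction of assignments to $X$ that satisfy $\varphi$, and $\|\varphi|\psi\|_X$ is the fraction of those satisfying $\varphi$ among those satisfying $\psi$. Under $\vec\tau$, $\zeta\approx_i\zeta'$ means $|\zeta-\zeta'|\le\tau_i$ and $\zeta\preceq_i\zeta'$ means $\zeta\le\zeta'+\tau_i$; a comparison involving a conditional proportion whose condition is satisfied by no assignment is vacuously true. $\mathrm{KB}\models\varphi$ means that $\varphi$ holds for every finite world, valuation and tolerance vector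 for which $\mathrm{KB}$ holds. For sentences $\varphi,\mathrm{KB}$, $\Pr_N^{\vec\tau}(\varphi|\mathrm{KB})$ is the fraction, among the worlds with domain size $N$ satisfying $\mathrm{KB}$ under $\vec\tau$, of those that satisfy $\varphi$. The degree of belief $\Pr_\infty(\varphi|\mathrm{KB})$ exists and equals $p$ if $\mathrm{KB}$ is eventually consistent (for all sufficiently small $\vec\tau$ and then all sufficiently large $N$, some world of size $N$ satisfies $\mathrm{KB}$) and $\lim_{\vec\tau\to0}\liminf_{N\to\infty}\Pr_N^{\vec\tau}(\varphi|\mathrm{KB})=\lim_{\vec\tau\to0}\limsup_{N\to\infty}\Pr_N^{\vec\tau}(\varphi|\mathrm{KB})=p$. **Corollary.** Let $c$ be a constant and $a,b$ numbers, let $\varphi_0(x),\theta(x),\xi(x)$ be formulas with no free variable other than $x$, such that $c$ occurs neither in $\theta(x)$ nor in $\xi(x)$, and let $\mathrm{KB}''$ be a sentence. Let $$\mathrm{KB}=\varphi_0(c)\wedge\bigl(a\preceq_i\|\theta(x)|\varphi_0(x)\|_x\preceq_j b\bigr)\wedge\mathrm{KB}''$$ and suppose that 1. $\mathrm{KB}\models\forall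 x(\xi(x)\Rightarrow\theta(x))$; 2. for every expression $\|\theta(x)|\varphi(x)\|_x$ occurring in $\mathrm{KB}$, either $\mathrm{KB}\models\forall x(\varphi_0(x)\Rightarrow\varphi(x))$ or $\mathrm{KB}\models\forall x(\varphi_0(x)\Rightarrow\neg\varphi(x))$; 3. for every expression $\|\xi(x)|\theta(x)\wedge\psi(x)\|_x$ occurring in $\mathrm{KB}$, either $\mathrm{KB}\models\forall x(\varphi_0(x)\Rightarrow\psi(x))$ or $\mathrm{KB}\models\forall x(\varphi_0(x)\Rightarrow\neg\psi(x))$; 4. every (nonlogical) symbol of $\theta$ appears in $\mathrm{KB}$ only inside the formula $\forall x(\xi(x)\Rightarrow\theta(x))$, on the left-hand side $\theta(x)$ of the expressions in 2, and in the conjunct $\theta(x)$ on the right-hand side of the expressions in 3; 5. every (nonlogical) symbol of $\xi$ appears in $\mathrm{KB}$ only inside the formula $\forall x(\xi(x)\Rightarrow\theta(x))$ and on the left-hand side $\xi(x)$ of the expressions in 3. Then, if the degree of belief $\Pr_\infty(\theta(c)|\mathrm{KB})$ exists, $\Pr_\infty(\theta(c)|\mathrm{KB})\in[a,b]$. -/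

import Mathlib

open Filter Topology

universe u v

namespace RandomWorlds

/-- The two sorts of the statistical language: formulas and proportion expressions. -/
inductive Kind
  | formula
  | proportion

/-- The syntax of the statistical first-order language `L^≈` over the vocabulary `L`.  Variables are
natural numbers (named variables), `X` is the finite set of variables bound by a proportion term. -/
inductive Syn (L : FirstOrder.Language.{u, v}) : Kind → Type (max u v)
  /-- `s = t` -/
  | equal (s t : L.Term ℕ) : Syn L .formula
  /-- `R(t₁, …, tₙ)` -/
  | rel {n : ℕ} (R : L.Relations n) (ts : Fin n → L.Term ℕ) : Syn L .formula
  /-- `¬ φ` -/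
  | neg (φ : Syn L .formula) : Syn L .formula
  /-- `φ ∧ ψ` -/
  | conj (φ ψ : Syn L .formula) : Syn L .formula
  /-- `∀ y, φ` -/
  | all (y : ℕ) (φ : Syn L .formula) : Syn L .formula
  /-- `ζ ≈ᵢ ζ'` -/
  | approxEq (i : ℕ) (ζ ζ' : Syn L .proportion) : Syn L .formula
  /-- `ζ ⪯ᵢ ζ'` -/
  | approxLe (i : ℕ) (ζ ζ' : Syn L .proportion) : Syn L .formula
  /-- a number -/
  | const (r : ℝ) : Syn L .proportion
  /-- `‖φ‖_X` -/
  | prop (X : Finset ℕ) (φ : Syn L .formula) : Syn L .proportion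
  /-- `‖φ | ψ‖_X` -/
  | condProp (X : Finset ℕ) (φ ψ : Syn L .formula) : Syn L .proportion
  /-- `ζ + ζ'` -/
  | add (ζ ζ' : Syn L .proportion) : Syn L .proportion
  /-- `ζ × ζ'` -/
  | mul (ζ ζ' : Syn L .proportion) : Syn L .proportion

/-- Formulas of `L^≈`. -/
abbrev Formula (L : FirstOrder.Language.{u, v}) := Syn L .formula

namespace Syn

variable {L : FirstOrder.Language.{u, v}}

/-- `φ ∨ ψ` -/
def disj (φ ψ : Formula L) : Formula L := neg (conj (neg φ) (neg ψ))

/-- `φ ⇒ ψ`, shorthand for `¬ φ ∨ ψ` -/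
def imp (φ ψ : Formula L) : Formula L := disj (neg φ) ψ

/-- The function and constant symbols that occur in a term. -/
def termSymbols : L.Term ℕ → Set L.Symbols
  | .var _ => ∅
  | .func (l := l) f ts => insert (Sum.inl ⟨l, f⟩) (⋃ i, termSymbols (ts i))

/-- The (nonlogical) symbols of the vocabulary that occur in a formula or proportion expression. -/
def symbols : {k : Kind} → Syn L k → Set L.Symbols
  | _, equal s t => termSymbols s ∪ termSymbols t
  | _, rel (n := n) R ts => insert (Sum.inr ⟨n, R⟩) (⋃ i, termSymbols (ts i))
  | _, neg φ => symbols φ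
  | _, conj φ ψ => symbols φ ∪ symbols ψ
  | _, all _ φ => symbols φ
  | _, approxEq _ ζ ζ' => symbols ζ ∪ symbols ζ'
  | _, approxLe _ ζ ζ' => symbols ζ ∪ symbols ζ'
  | _, const _ => ∅
  | _, prop _ φ => symbols φ
  | _, condProp _ φ ψ => symbols φ ∪ symbols ψ
  | _, add ζ ζ' => symbols ζ ∪ symbols ζ'
  | _, mul ζ ζ' => symbols ζ ∪ symbols ζ'

/-- The free variables of a formula or proportion expression. -/
def freeVars : {k : Kind} → Syn L k → Set ℕ
  | _, equal s t => s.varFinset ∪ t.varFinset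
  | _, rel _ ts => ⋃ i, (ts i).varFinset
  | _, neg φ => freeVars φ
  | _, conj φ ψ => freeVars φ ∪ freeVars ψ
  | _, all y φ => freeVars φ \ {y}
  | _, approxEq _ ζ ζ' => freeVars ζ ∪ freeVars ζ'
  | _, approxLe _ ζ ζ' => freeVars ζ ∪ freeVars ζ'
  | _, const _ => ∅
  | _, prop X φ => freeVars φ \ X
  | _, condProp X φ ψ => (freeVars φ ∪ freeVars ψ) \ X
  | _, add ζ ζ' => freeVars ζ ∪ freeVars ζ'
  | _, mul ζ ζ' => freeVars ζ ∪ freeVars ζ'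

/-- `e.inst x c`: the constant `c` is substituted for the free occurrences of the variable `x`;
for a formula `φ(x)` this is `φ(c)`. -/
def inst (x : ℕ) (c : L.Constants) : {k : Kind} → Syn L k → Syn L k
  | _, equal s t => equal (s.subst (Function.update .var x c.term))
      (t.subst (Function.update .var x c.term))
  | _, rel R ts => rel R (fun i => (ts i).subst (Function.update .var x c.term))
  | _, neg φ => neg (inst x c φ)
  | _, conj φ ψ => conj (inst x c φ) (inst x c ψ)
  | _, all y φ => if y = x then all y φ else all y (inst x c φ)
  | _, approxEq i ζ ζ' => approxEq i (inst x c ζ) (inst x c ζ')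
  | _, approxLe i ζ ζ' => approxLe i (inst x c ζ) (inst x c ζ')
  | _, const r => const r
  | _, prop X φ => if x ∈ X then prop X φ else prop X (inst x c φ)
  | _, condProp X φ ψ =>
      if x ∈ X then condProp X φ ψ else condProp X (inst x c φ) (inst x c ψ)
  | _, add ζ ζ' => add (inst x c ζ) (inst x c ζ')
  | _, mul ζ ζ' => mul (inst x c ζ) (inst x c ζ')

/-- The conditional proportion terms `‖φ | ψ‖_X` that occur (at any depth) in a formula or
proportion expression, as triples `(X, φ, ψ)`. -/
def condTerms : {k : Kind} → Syn L k → Set (Finset ℕ × Formula L × Formula L)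
  | _, equal _ _ => ∅
  | _, rel _ _ => ∅
  | _, neg φ => condTerms φ
  | _, conj φ ψ => condTerms φ ∪ condTerms ψ
  | _, all _ φ => condTerms φ
  | _, approxEq _ ζ ζ' => condTerms ζ ∪ condTerms ζ'
  | _, approxLe _ ζ ζ' => condTerms ζ ∪ condTerms ζ'
  | _, const _ => ∅
  | _, prop _ φ => condTerms φ
  | _, condProp X φ ψ => insert (X, φ, ψ) (condTerms φ ∪ condTerms ψ)
  | _, add ζ ζ' => condTerms ζ ∪ condTerms ζ'
  | _, mul ζ ζ' => condTerms ζ ∪ condTerms ζ'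

open Classical in
/-- The symbols that have an occurrence in the given formula or proportion expression other than

* inside a subformula `∀ x (ξ(x) ⇒ θ(x))`,
* on the left-hand side of a conditional proportion term `‖θ(x) | φ(x)‖_x`,
* in the conjunct `θ(x)` on the right-hand side of a conditional proportion term
  `‖ξ(x) | θ(x) ∧ ψ(x)‖_x`.

The flag `rhs` records that the expression is the right-hand side of a term `‖ξ(x) | ·‖_x`. -/
def straysTheta (x : ℕ) (θ ξ : Formula L) : (rhs : Prop) → {k : Kind} → Syn L k → Set L.Symbols
  | _, _, equal s t => termSymbols s ∪ termSymbols t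
  | _, _, rel (n := n) R ts => insert (Sum.inr ⟨n, R⟩) (⋃ i, termSymbols (ts i))
  | _, _, neg φ => straysTheta x θ ξ False φ
  | rhs, _, conj φ ψ =>
      (if rhs ∧ φ = θ then ∅ else straysTheta x θ ξ False φ) ∪ straysTheta x θ ξ False ψ
  | _, _, all y φ => if y = x ∧ φ = imp ξ θ then ∅ else straysTheta x θ ξ False φ
  | _, _, approxEq _ ζ ζ' => straysTheta x θ ξ False ζ ∪ straysTheta x θ ξ False ζ'
  | _, _, approxLe _ ζ ζ' => straysTheta x θ ξ False ζ ∪ straysTheta x θ ξ False ζ'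
  | _, _, const _ => ∅
  | _, _, prop _ φ => straysTheta x θ ξ False φ
  | _, _, condProp X φ ψ =>
      (if X = {x} ∧ φ = θ then ∅ else straysTheta x θ ξ False φ) ∪
        straysTheta x θ ξ (X = {x} ∧ φ = ξ) ψ
  | _, _, add ζ ζ' => straysTheta x θ ξ False ζ ∪ straysTheta x θ ξ False ζ'
  | _, _, mul ζ ζ' => straysTheta x θ ξ False ζ ∪ straysTheta x θ ξ False ζ'

open Classical in
/-- The symbols that have an occurrence in the given formula or proportion expression other than

* inside a subformula `∀ x (ξ(x) ⇒ θ(x))`,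
* on the left-hand side of a conditional proportion term `‖ξ(x) | θ(x) ∧ ψ(x)‖_x`. -/
def straysXi (x : ℕ) (θ ξ : Formula L) : {k : Kind} → Syn L k → Set L.Symbols
  | _, equal s t => termSymbols s ∪ termSymbols t
  | _, rel (n := n) R ts => insert (Sum.inr ⟨n, R⟩) (⋃ i, termSymbols (ts i))
  | _, neg φ => straysXi x θ ξ φ
  | _, conj φ ψ => straysXi x θ ξ φ ∪ straysXi x θ ξ ψ
  | _, all y φ => if y = x ∧ φ = imp ξ θ then ∅ else straysXi x θ ξ φ
  | _, approxEq _ ζ ζ' => straysXi x θ ξ ζ ∪ straysXi x θ ξ ζ'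
  | _, approxLe _ ζ ζ' => straysXi x θ ξ ζ ∪ straysXi x θ ξ ζ'
  | _, const _ => ∅
  | _, prop _ φ => straysXi x θ ξ φ
  | _, condProp X φ ψ =>
      (if X = {x} ∧ φ = ξ ∧ ∃ χ, ψ = conj θ χ then ∅ else straysXi x θ ξ φ) ∪ straysXi x θ ξ ψ
  | _, add ζ ζ' => straysXi x θ ξ ζ ∪ straysXi x θ ξ ζ'
  | _, mul ζ ζ' => straysXi x θ ξ ζ ∪ straysXi x θ ξ ζ'

/-- Semantic values: formulas are true or false, proportion expressions denote a number, or nothing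
(`none`) if a conditional proportion in them has an empty condition. -/
abbrev Value : Kind → Type
  | .formula => Prop
  | .proportion => Option ℝ

/-- The valuation that agrees with `d` on the variables in `X` and with `V` elsewhere. -/
def override {M : Type*} (V : ℕ → M) (X : Finset ℕ) (d : X → M) : ℕ → M :=
  fun y => if h : y ∈ X then d ⟨y, h⟩ else V y

/-- The number of assignments of domain elements to the variables in `X` for which `P` holds. -/
noncomputable def count {M : Type*} (V : ℕ → M) (X : Finset ℕ) (P : (ℕ → M) → Prop) : ℕ :=
  Nat.card {d : X → M // P (override V X d)}

open Classical in
/-- The semantics: the value of a formula or proportion expression in the world `W` (a finite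
structure) under the tolerance vector `τ` and the valuation `V`.  A comparison that involves a
conditional proportion with an empty condition is vacuously true. -/
noncomputable def eval {M : Type} (W : L.Structure M) (τ : ℕ → ℝ) :
    {k : Kind} → Syn L k → (ℕ → M) → Value k
  | _, equal s t, V => s.realize V = t.realize V
  | _, rel R ts, V => W.RelMap R (fun i => (ts i).realize V)
  | _, neg φ, V => ¬ eval W τ φ V
  | _, conj φ ψ, V => eval W τ φ V ∧ eval W τ ψ V
  | _, all y φ, V => ∀ d : M, eval W τ φ (Function.update V y d)
  | _, approxEq i ζ ζ', V => ∀ r ∈ eval W τ ζ V, ∀ r' ∈ eval W τ ζ' V, |r - r'| ≤ τ i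
  | _, approxLe i ζ ζ', V => ∀ r ∈ eval W τ ζ V, ∀ r' ∈ eval W τ ζ' V, r ≤ r' + τ i
  | _, const r, _ => some r
  | _, prop X φ, V => some ((count V X (eval W τ φ) : ℝ) / (Nat.card M : ℝ) ^ X.card)
  | _, condProp X φ ψ, V =>
      if count V X (eval W τ ψ) = 0 then none
      else some ((count V X (fun V' => eval W τ φ V' ∧ eval W τ ψ V') : ℝ) /
        (count V X (eval W τ ψ) : ℝ))
  | _, add ζ ζ', V => (eval W τ ζ V).bind fun r => (eval W τ ζ' V).map fun r' => r + r'
  | _, mul ζ ζ', V => (eval W τ ζ V).bind fun r => (eval W τ ζ' V).map fun r' => r * r'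

end Syn

variable {L : FirstOrder.Language.{u, v}}

/-- The tolerance vectors: all entries are positive. -/
def Tolerances : Set (ℕ → ℝ) := {τ | ∀ i, 0 < τ i}

/-- `KB ⊨ φ`: every finite world, valuation and tolerance vector that satisfies `KB` satisfies
`φ`. -/
def Entails (KB φ : Formula L) : Prop :=
  ∀ (N : ℕ) (W : L.Structure (Fin N)) (V : ℕ → Fin N), ∀ τ ∈ Tolerances,
    KB.eval W τ V → φ.eval W τ V

/-- The number of worlds with domain of size `N` that satisfy the sentence `φ` under `τ`. -/
noncomputable def numWorlds (N : ℕ) (τ : ℕ → ℝ) (φ : Formula L) : ℕ :=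
  Nat.card {W : L.Structure (Fin N) // ∀ V : ℕ → Fin N, φ.eval W τ V}

/-- `Pr_N^τ(φ | KB)`: the fraction of the worlds of size `N` satisfying `KB` that satisfy `φ`. -/
noncomputable def Pr (N : ℕ) (τ : ℕ → ℝ) (φ KB : Formula L) : ℝ :=
  (numWorlds N τ (Syn.conj φ KB) : ℝ) / (numWorlds N τ KB : ℝ)

/-- The filter `τ → 0` on tolerance vectors. -/
def toZero : Filter (ℕ → ℝ) := 𝓝[Tolerances] 0

/-- For all small enough tolerance vectors, `KB` has worlds of every large enough size. -/
def EventuallyConsistent (KB : Formula L) : Prop :=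
  ∀ᶠ τ in toZero, ∀ᶠ N in atTop, 0 < numWorlds N τ KB

/-- The degree of belief `Pr_∞(φ | KB)` exists and equals `p`: `KB` is eventually consistent, and
`lim_{τ → 0} liminf_{N → ∞}` and `lim_{τ → 0} limsup_{N → ∞}` of `Pr_N^τ(φ | KB)` both exist and
equal `p`. -/
def HasDegreeOfBelief (φ KB : Formula L) (p : ℝ) : Prop :=
  EventuallyConsistent KB ∧
  Tendsto (fun τ => liminf (fun N => Pr N τ φ KB) atTop) toZero (𝓝 p) ∧
  Tendsto (fun τ => limsup (fun N => Pr N τ φ KB) atTop) toZero (𝓝 p)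

end RandomWorlds

/-! Fix a size `N` and a positive tolerance vector `τ`. The bounds rest on a symmetry: in the worlds
of `KB`, the element named by `c` is a typical member of the reference class `φ₀` as far as `θ` is
concerned.

Take a world of `KB`, let `m` be the denotation of `c`, and let `d` satisfy `φ₀`. Transport only the
symbols of `θ` and `ξ` along the transposition of `m` and `d`. This moves the extensions of `θ` and
`ξ` by the transposition and fixes `c`, which occurs in neither formula. `KB` survives
(`MovedBy.eval_eq`): these symbols occur only in `∀ x (ξ ⇒ θ)`, which is insensitive to a
permutation, and in proportions whose remaining condition is constant on `φ₀`, hence invariant under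
the transposition. Apart from one degenerate case, treated directly, the class `φ₀` survives too.
The move is an involution that trades "`d` satisfies `θ`" for "`c` satisfies `θ`".

Double counting pairs of a world and a member of its class (`sum_proportion_eq_card`,
`sum_proportion_eq`) shows that `Pr N τ (θ.inst x c) KB` is the average of the proportion of `θ` in
`φ₀` over the worlds of `KB`. Each such proportion lies in `[a - τ i, b + τ j]`, and so does the
average. Letting `N → ∞` and then `τ → 0` gives `[a, b]`. -/

namespace RandomWorlds

namespace Syn

variable {L : FirstOrder.Language.{u, v}}

/-! ### Terms and assignments -/

theorem termSymbols_arg_subset {l : ℕ} (f : L.Functions l) (ts : Fin l → L.Term ℕ) (i : Fin l) :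
    termSymbols (ts i) ⊆ termSymbols (.func f ts) := by
  intro s hs
  simp only [termSymbols]
  exact Or.inr (Set.mem_iUnion.2 ⟨i, hs⟩)

/-- Two structures on `M` are matched by the permutation `π` on the symbols in `S`. -/
structure MatchedOn {M : Type} (W W' : L.Structure M) (π : Equiv.Perm M) (S : Set L.Symbols) :
    Prop where
  fun_eq : ∀ {n : ℕ} (f : L.Functions n) (a : Fin n → M), Sum.inl ⟨n, f⟩ ∈ S →
    W'.funMap f (π ∘ a) = π (W.funMap f a)
  rel_iff : ∀ {n : ℕ} (R : L.Relations n) (a : Fin n → M), Sum.inr ⟨n, R⟩ ∈ S →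
    (W'.RelMap R (π ∘ a) ↔ W.RelMap R a)

theorem MatchedOn.realize {M : Type} {W W' : L.Structure M} {π : Equiv.Perm M}
    {S : Set L.Symbols} (h : MatchedOn W W' π S) (t : L.Term ℕ) (ht : termSymbols t ⊆ S)
    (V : ℕ → M) :
    @FirstOrder.Language.Term.realize L M W' ℕ (π ∘ V) t =
      π (@FirstOrder.Language.Term.realize L M W ℕ V t) := by
  induction t with
  | var y => rfl
  | func f ts ih =>
    simp only [FirstOrder.Language.Term.realize]
    rw [← h.fun_eq f _ (ht (by simp [termSymbols]))]
    congr 1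
    funext i
    exact ih i ((termSymbols_arg_subset f ts i).trans ht)

theorem override_comp {M : Type} (π : M → M) (V : ℕ → M) (X : Finset ℕ) (d : X → M) :
    override (π ∘ V) X (π ∘ d) = π ∘ override V X d := by
  funext y
  simp only [override, Function.comp]
  split_ifs <;> rfl

theorem count_perm {M : Type} (π : Equiv.Perm M) (V : ℕ → M) (X : Finset ℕ)
    {P P' : (ℕ → M) → Prop} (h : ∀ U, P' (π ∘ U) ↔ P U) :
    count (π ∘ V) X P' = count V X P := by
  refine (Nat.card_congr (Equiv.subtypeEquiv (Equiv.arrowCongr (Equiv.refl _) π) ?_)).symm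
  intro d
  rw [← h, ← override_comp]
  rfl

theorem override_singleton {M : Type} (V : ℕ → M) (x : ℕ) (d : ({x} : Finset ℕ) → M) :
    override V {x} d = Function.update V x (d default) := by
  funext y
  by_cases h : y = x
  · subst h
    simp only [override, Finset.mem_singleton, dite_true, Function.update_self]
    congr
  · simp [override, h]

theorem count_singleton {M : Type} (V : ℕ → M) (x : ℕ) (P : (ℕ → M) → Prop) :
    count V {x} P = Nat.card {d : M // P (Function.update V x d)} := by
  refine Nat.card_congr (Equiv.subtypeEquiv (Equiv.funUnique ({x} : Finset ℕ) M) ?_)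
  intro d
  rw [override_singleton]
  rfl

/-! ### Isomorphism invariance, dependence on free variables, substitution -/

/-- The isomorphism lemma relative to a set of symbols. It serves twice: with a transposition on the
symbols of `θ` and `ξ`, and, through its term and relation parts, with the identity on all the
others. -/
theorem MatchedOn.eval {M : Type} {W W' : L.Structure M} {π : Equiv.Perm M}
    {S : Set L.Symbols} (h : MatchedOn W W' π S) (τ : ℕ → ℝ) {k : Kind} (e : Syn L k)
    (he : e.symbols ⊆ S) (V : ℕ → M) : eval W' τ e (π ∘ V) = eval W τ e V := by
  induction e generalizing V with
  | equal s t =>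
    simp only [symbols, Set.union_subset_iff] at he
    simp only [Syn.eval, h.realize s he.1, h.realize t he.2, π.injective.eq_iff]
  | rel R ts =>
    have hR := h.rel_iff R (fun i => @FirstOrder.Language.Term.realize L M W ℕ V (ts i))
      (he (by simp [symbols]))
    simp only [Syn.eval]
    rw [← propext hR]
    congr 1
    funext i
    refine h.realize (ts i) (fun s hs => he ?_) V
    simp only [symbols]
    exact Or.inr (Set.mem_iUnion.2 ⟨i, hs⟩)
  | neg φ ih => simp only [Syn.eval, ih he]
  | conj φ ψ ih₁ ih₂ =>
    simp only [symbols, Set.union_subset_iff] at he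
    simp only [Syn.eval, ih₁ he.1, ih₂ he.2]
  | all y φ ih =>
    simp only [Syn.eval]
    refine propext ((π.forall_congr fun d => ?_).symm)
    rw [← ih he, Function.comp_update]
  | approxEq i ζ ζ' ih₁ ih₂ =>
    simp only [symbols, Set.union_subset_iff] at he
    simp only [Syn.eval, ih₁ he.1, ih₂ he.2]
  | approxLe i ζ ζ' ih₁ ih₂ =>
    simp only [symbols, Set.union_subset_iff] at he
    simp only [Syn.eval, ih₁ he.1, ih₂ he.2]
  | const r => rfl
  | prop X φ ih =>
    simp only [Syn.eval]
    rw [count_perm π V X (fun U => Eq.to_iff (ih he U))]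
  | condProp X φ ψ ih₁ ih₂ =>
    simp only [symbols, Set.union_subset_iff] at he
    simp only [Syn.eval]
    rw [count_perm π V X (fun U => Eq.to_iff (ih₂ he.2 U)),
      count_perm π V X (fun U => and_congr (Eq.to_iff (ih₁ he.1 U)) (Eq.to_iff (ih₂ he.2 U)))]
  | add ζ ζ' ih₁ ih₂ =>
    simp only [symbols, Set.union_subset_iff] at he
    simp only [Syn.eval, ih₁ he.1, ih₂ he.2]
  | mul ζ ζ' ih₁ ih₂ =>
    simp only [symbols, Set.union_subset_iff] at he
    simp only [Syn.eval, ih₁ he.1, ih₂ he.2]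

theorem count_congr {M : Type} {V V' : ℕ → M} {X : Finset ℕ} {P P' : (ℕ → M) → Prop}
    (h : ∀ d, P (override V X d) ↔ P' (override V' X d)) : count V X P = count V' X P' :=
  Nat.card_congr (Equiv.subtypeEquivRight h)

theorem override_eqOn {M : Type} {V V' : ℕ → M} {X : Finset ℕ} {F : Set ℕ}
    (h : Set.EqOn V V' (F \ X)) (d : X → M) : Set.EqOn (override V X d) (override V' X d) F := by
  intro y hy
  simp only [override]
  split_ifs with hX
  · rfl
  · exact h ⟨hy, hX⟩

theorem eval_congr {M : Type} (W : L.Structure M) (τ : ℕ → ℝ) {k : Kind} (e : Syn L k)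
    {V V' : ℕ → M} (h : Set.EqOn V V' e.freeVars) : eval W τ e V = eval W τ e V' := by
  have term : ∀ (t : L.Term ℕ) {V V' : ℕ → M}, Set.EqOn V V' t.varFinset →
      t.realize V = t.realize V' := by
    intro t V V' h
    induction t with
    | var y => exact h (by simp)
    | func f ts ih =>
      simp only [FirstOrder.Language.Term.realize]
      congr 1
      funext i
      exact ih i (h.mono fun y hy => by
        simp only [FirstOrder.Language.Term.varFinset, Finset.coe_biUnion, Set.mem_iUnion]
        exact ⟨i, by simp, hy⟩)
  induction e generalizing V V' with
  | equal s t =>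
    simp only [freeVars, Set.eqOn_union] at h
    simp only [eval, term s h.1, term t h.2]
  | rel R ts =>
    simp only [eval]
    congr 1
    funext i
    refine term (ts i) (h.mono fun y hy => ?_)
    simp only [freeVars]
    exact Set.mem_iUnion.2 ⟨i, hy⟩
  | neg φ ih => simp only [eval, ih h]
  | conj φ ψ ih₁ ih₂ =>
    simp only [freeVars, Set.eqOn_union] at h
    simp only [eval, ih₁ h.1, ih₂ h.2]
  | all y φ ih =>
    simp only [eval]
    refine propext (forall_congr' fun d => Eq.to_iff (ih fun z hz => ?_))
    by_cases hzy : z = y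
    · simp [hzy]
    · simp only [Function.update_of_ne hzy]
      exact h ⟨hz, hzy⟩
  | approxEq i ζ ζ' ih₁ ih₂ =>
    simp only [freeVars, Set.eqOn_union] at h
    simp only [eval, ih₁ h.1, ih₂ h.2]
  | approxLe i ζ ζ' ih₁ ih₂ =>
    simp only [freeVars, Set.eqOn_union] at h
    simp only [eval, ih₁ h.1, ih₂ h.2]
  | const r => rfl
  | prop X φ ih =>
    simp only [eval]
    rw [count_congr fun d => Eq.to_iff (ih (override_eqOn h d))]
  | condProp X φ ψ ih₁ ih₂ =>
    have hd := fun d => Set.eqOn_union.1 (override_eqOn h d)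
    simp only [eval]
    have hψ : count V X (eval W τ ψ) = count V' X (eval W τ ψ) :=
      count_congr fun d => Eq.to_iff (ih₂ (hd d).2)
    have hφψ : count V X (fun U => eval W τ φ U ∧ eval W τ ψ U) =
        count V' X (fun U => eval W τ φ U ∧ eval W τ ψ U) :=
      count_congr fun d => and_congr (Eq.to_iff (ih₁ (hd d).1)) (Eq.to_iff (ih₂ (hd d).2))
    rw [hψ, hφψ]
  | add ζ ζ' ih₁ ih₂ =>
    simp only [freeVars, Set.eqOn_union] at h
    simp only [eval, ih₁ h.1, ih₂ h.2]
  | mul ζ ζ' ih₁ ih₂ =>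
    simp only [freeVars, Set.eqOn_union] at h
    simp only [eval, ih₁ h.1, ih₂ h.2]

/-- The value at `update V x d` of a formula with no free variable other than `x` does not depend
on `V`. -/
theorem eval_update {M : Type} (W : L.Structure M) (τ : ℕ → ℝ) {k : Kind} {e : Syn L k} {x : ℕ}
    (he : e.freeVars ⊆ {x}) {V V' : ℕ → M} (h : V x = V' x) : eval W τ e V = eval W τ e V' :=
  eval_congr W τ e fun y hy => by
    obtain rfl : y = x := he hy
    exact h

/-- The denotation of the constant `c` in `W`. -/
def constVal {M : Type} (W : L.Structure M) (c : L.Constants) : M := W.funMap c default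

theorem realize_inst {M : Type} (W : L.Structure M) (x : ℕ) (c : L.Constants) (t : L.Term ℕ)
    (V : ℕ → M) : (t.subst (Function.update .var x c.term)).realize V =
      t.realize (Function.update V x (constVal W c)) := by
  rw [FirstOrder.Language.Term.realize_subst]
  congr 1
  funext y
  by_cases h : y = x
  · subst h
    simp only [Function.update_self, FirstOrder.Language.Constants.term,
      FirstOrder.Language.Term.realize, constVal]
    congr 1
    exact Subsingleton.elim _ _
  · simp [h]

theorem override_update_mem {M : Type} (V : ℕ → M) {X : Finset ℕ} {x : ℕ} (hx : x ∈ X) (m : M)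
    (d : X → M) : override (Function.update V x m) X d = override V X d := by
  funext y
  simp only [override]
  split_ifs with hy
  · rfl
  · exact Function.update_of_ne (ne_of_mem_of_not_mem hx hy).symm _ _

theorem override_update_notMem {M : Type} (V : ℕ → M) {X : Finset ℕ} {x : ℕ} (hx : x ∉ X) (m : M)
    (d : X → M) :
    override (Function.update V x m) X d = Function.update (override V X d) x m := by
  funext y
  by_cases hy : y = x
  · subst hy
    simp [override, hx]
  · simp [override, hy]

/-- No variable capture can arise, since a constant contains no variables; a binder of `x` simply
shadows the updated value. -/
theorem eval_inst {M : Type} (W : L.Structure M) (τ : ℕ → ℝ) (x : ℕ) (c : L.Constants)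
    {k : Kind} (e : Syn L k) (V : ℕ → M) :
    eval W τ (inst x c e) V = eval W τ e (Function.update V x (constVal W c)) := by
  induction e generalizing V with
  | equal s t => simp only [inst, eval, realize_inst]
  | rel R ts => simp only [inst, eval, realize_inst]
  | neg φ ih => simp only [inst, eval, ih]
  | conj φ ψ ih₁ ih₂ => simp only [inst, eval, ih₁, ih₂]
  | all y φ ih =>
    simp only [inst]
    split_ifs with h
    · subst h
      simp only [eval, Function.update_idem]
    · simp only [eval, ih, Function.update_comm (Ne.symm h)]
  | approxEq i ζ ζ' ih₁ ih₂ => simp only [inst, eval, ih₁, ih₂]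
  | approxLe i ζ ζ' ih₁ ih₂ => simp only [inst, eval, ih₁, ih₂]
  | const r => rfl
  | prop X φ ih =>
    simp only [inst]
    split_ifs with h
    · simp only [eval, count, override_update_mem V h]
    · simp only [eval, count, override_update_notMem V h, ih]
  | condProp X φ ψ ih₁ ih₂ =>
    simp only [inst]
    split_ifs with h
    · have hc : ∀ P, count (Function.update V x (constVal W c)) X P = count V X P := fun P =>
        count_congr fun d => by rw [override_update_mem V h]
      simp only [eval]
      rw [hc, hc]
    · simp only [eval, count, override_update_notMem V h, ih₁, ih₂]
  | add ζ ζ' ih₁ ih₂ => simp only [inst, eval, ih₁, ih₂]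
  | mul ζ ζ' ih₁ ih₂ => simp only [inst, eval, ih₁, ih₂]

theorem eval_imp {M : Type} (W : L.Structure M) (τ : ℕ → ℝ) (φ ψ : Formula L) (V : ℕ → M) :
    eval W τ (imp φ ψ) V ↔ (eval W τ φ V → eval W τ ψ V) := by
  simp only [imp, disj, eval]
  tauto

end Syn
end RandomWorlds

namespace RandomWorlds

namespace Syn

variable {L : FirstOrder.Language.{u, v}}

/-! ### Permuting the denotations of some of the symbols -/

open Classical in
/-- The structure `W` with the denotations of the symbols in `S` transported along `π`. -/
@[reducible]
noncomputable def permuteOn {M : Type} (S : Set L.Symbols) (π : Equiv.Perm M)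
    (W : L.Structure M) : L.Structure M where
  funMap := fun {n} f a =>
    if Sum.inl ⟨n, f⟩ ∈ S then π (W.funMap f (π.symm ∘ a)) else W.funMap f a
  RelMap := fun {n} R a =>
    if Sum.inr ⟨n, R⟩ ∈ S then W.RelMap R (π.symm ∘ a) else W.RelMap R a

open Classical in
theorem permuteOn_funMap {M : Type} (S : Set L.Symbols) (π : Equiv.Perm M) (W : L.Structure M)
    {n : ℕ} (f : L.Functions n) (a : Fin n → M) :
    (permuteOn S π W).funMap f a =
      if Sum.inl ⟨n, f⟩ ∈ S then π (W.funMap f (π.symm ∘ a)) else W.funMap f a :=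
  rfl

open Classical in
theorem permuteOn_relMap {M : Type} (S : Set L.Symbols) (π : Equiv.Perm M) (W : L.Structure M)
    {n : ℕ} (R : L.Relations n) (a : Fin n → M) :
    (permuteOn S π W).RelMap R a =
      if Sum.inr ⟨n, R⟩ ∈ S then W.RelMap R (π.symm ∘ a) else W.RelMap R a :=
  rfl

open Classical in
theorem matchedOn_permuteOn {M : Type} (S : Set L.Symbols) (π : Equiv.Perm M)
    (W : L.Structure M) : MatchedOn W (permuteOn S π W) π S where
  fun_eq f a hf := by
    rw [permuteOn_funMap, if_pos hf, ← Function.comp_assoc, Equiv.symm_comp_self,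
      Function.id_comp]
  rel_iff R a hR := by
    rw [permuteOn_relMap, if_pos hR, ← Function.comp_assoc, Equiv.symm_comp_self,
      Function.id_comp]

open Classical in
theorem matchedOn_permuteOn_compl {M : Type} (S : Set L.Symbols) (π : Equiv.Perm M)
    (W : L.Structure M) : MatchedOn W (permuteOn S π W) (Equiv.refl M) Sᶜ where
  fun_eq f a hf := (permuteOn_funMap S π W f a).trans (if_neg hf)
  rel_iff R a hR := Eq.to_iff ((permuteOn_relMap S π W R a).trans (if_neg hR))

open Classical in
-- Supplies the involution needed for the double counting.
theorem permuteOn_swap_swap {M : Type} [DecidableEq M] (S : Set L.Symbols) (m d : M)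
    (W : L.Structure M) :
    permuteOn S (Equiv.swap m d) (permuteOn S (Equiv.swap m d) W) = W := by
  have hs : (Equiv.swap m d : M → M) ∘ (Equiv.swap m d) = id := by
    funext y
    simp
  refine FirstOrder.Language.Structure.ext ?_ ?_
  · funext n f a
    rw [permuteOn_funMap, permuteOn_funMap]
    split_ifs
    · simp [← Function.comp_assoc, hs]
    · rw [permuteOn_funMap, if_neg ‹_›]
  · funext n R a
    rw [permuteOn_relMap, permuteOn_relMap]
    split_ifs
    · simp [← Function.comp_assoc, hs]
    · rw [permuteOn_relMap, if_neg ‹_›]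

/-! ### Invariance of formulas in which the permuted symbols occur only in permitted places -/

/-- The flag is consulted only at a conjunction whose left conjunct is `θ`. -/
theorem straysTheta_rhs_irrelevant {x : ℕ} {θ ξ ψ : Formula L} (h : ∀ χ, ψ ≠ conj θ χ)
    (rhs : Prop) : straysTheta x θ ξ rhs ψ = straysTheta x θ ξ False ψ := by
  cases ψ with
  | conj α χ =>
    have hα : α ≠ θ := fun hα => h χ (by rw [hα])
    simp [straysTheta, hα]
  | _ => simp [straysTheta]

/-- `W'` looks like `W` except that the extensions of `θ(x)` and `ξ(x)` are moved by `π`, and `π`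
preserves the conditions with which `θ(x)` and `ξ(x)` are related in `C`. -/
structure MovedBy {M : Type} (W W' : L.Structure M) (τ : ℕ → ℝ) (π : Equiv.Perm M) (x : ℕ)
    (θ ξ : Formula L) (C : Set (Finset ℕ × Formula L × Formula L)) : Prop where
  matched : MatchedOn W W' (Equiv.refl M) (θ.symbols ∪ ξ.symbols)ᶜ
  left : ∀ V d, eval W' τ θ (Function.update V x (π d)) ↔ eval W τ θ (Function.update V x d)
  right : ∀ V d, eval W' τ ξ (Function.update V x (π d)) ↔ eval W τ ξ (Function.update V x d)
  cond_left : ∀ φ, ({x}, θ, φ) ∈ C → ∀ V d,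
    eval W τ φ (Function.update V x (π d)) ↔ eval W τ φ (Function.update V x d)
  cond_right : ∀ ψ, ({x}, ξ, conj θ ψ) ∈ C → ∀ V d,
    eval W τ ψ (Function.update V x (π d)) ↔ eval W τ ψ (Function.update V x d)

theorem count_singleton_perm {M : Type} (π : Equiv.Perm M) (V : ℕ → M) (x : ℕ)
    {P P' : (ℕ → M) → Prop}
    (h : ∀ d, P' (Function.update V x (π d)) ↔ P (Function.update V x d)) :
    count V {x} P' = count V {x} P := by
  rw [count_singleton, count_singleton]
  exact (Nat.card_congr (Equiv.subtypeEquiv π fun d => (h d).symm)).symm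

theorem eval_condProp_congr {M : Type} {W W' : L.Structure M} {τ : ℕ → ℝ} {X : Finset ℕ}
    {φ ψ : Formula L} {V : ℕ → M}
    (h₁ : count V X (eval W' τ ψ) = count V X (eval W τ ψ))
    (h₂ : count V X (fun U => eval W' τ φ U ∧ eval W' τ ψ U) =
      count V X (fun U => eval W τ φ U ∧ eval W τ ψ U)) :
    eval W' τ (condProp X φ ψ) V = eval W τ (condProp X φ ψ) V := by
  simp only [eval]
  rw [h₁, h₂]

variable {M : Type} {W W' : L.Structure M} {τ : ℕ → ℝ} {π : Equiv.Perm M} {x : ℕ}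
  {θ ξ : Formula L} {C : Set (Finset ℕ × Formula L × Formula L)}

theorem MovedBy.eval_all_imp (h : MovedBy W W' τ π x θ ξ C) (V : ℕ → M) :
    eval W' τ (all x (imp ξ θ)) V = eval W τ (all x (imp ξ θ)) V := by
  simp only [eval, eval_imp]
  exact propext (π.forall_congr fun d => by rw [h.left, h.right]).symm

theorem MovedBy.realize (h : MovedBy W W' τ π x θ ξ C) (t : L.Term ℕ)
    (h₁ : Disjoint θ.symbols (termSymbols t)) (h₂ : Disjoint ξ.symbols (termSymbols t))
    (V : ℕ → M) : @FirstOrder.Language.Term.realize L M W' ℕ V t =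
      @FirstOrder.Language.Term.realize L M W ℕ V t :=
  h.matched.realize t (Set.disjoint_left.1 (Set.disjoint_union_left.2 ⟨h₁, h₂⟩).symm) V

theorem MovedBy.rel_iff (h : MovedBy W W' τ π x θ ξ C) {n : ℕ} (R : L.Relations n)
    (h₁ : Sum.inr ⟨n, R⟩ ∉ θ.symbols) (h₂ : Sum.inr ⟨n, R⟩ ∉ ξ.symbols) (a : Fin n → M) :
    W'.RelMap R a ↔ W.RelMap R a :=
  h.matched.rel_iff R a (by simp [h₁, h₂])

/-- An expression in which the symbols of `θ` and `ξ` occur only in permitted places has the same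
value in both structures. -/
theorem MovedBy.eval_eq (h : MovedBy W W' τ π x θ ξ C) {k : Kind} (e : Syn L k)
    (hC : e.condTerms ⊆ C) (hθ : Disjoint θ.symbols (straysTheta x θ ξ False e))
    (hξ : Disjoint ξ.symbols (straysXi x θ ξ e)) (V : ℕ → M) :
    eval W' τ e V = eval W τ e V := by
  match e with
  | equal s t =>
    simp only [straysTheta, straysXi, Set.disjoint_union_right] at hθ hξ
    simp only [eval, h.realize s hθ.1 hξ.1, h.realize t hθ.2 hξ.2]
  | rel R ts =>
    simp only [straysTheta, straysXi, Set.disjoint_insert_right, Set.disjoint_iUnion_right]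
      at hθ hξ
    simp only [eval, h.realize (ts _) (hθ.2 _) (hξ.2 _)]
    exact propext (h.rel_iff R hθ.1 hξ.1 _)
  | neg φ =>
    simp only [straysTheta, straysXi, condTerms] at hθ hξ hC
    simp only [eval, h.eval_eq φ hC hθ hξ]
  | conj φ ψ =>
    simp only [straysTheta, straysXi, condTerms, Set.disjoint_union_right,
      Set.union_subset_iff, false_and, if_false] at hθ hξ hC
    simp only [eval, h.eval_eq φ hC.1 hθ.1 hξ.1, h.eval_eq ψ hC.2 hθ.2 hξ.2]
  | all y φ =>
    by_cases hy : y = x ∧ φ = imp ξ θ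
    · obtain ⟨rfl, rfl⟩ := hy
      exact h.eval_all_imp V
    · simp only [straysTheta, straysXi, condTerms, if_neg hy] at hθ hξ hC
      simp only [eval, h.eval_eq φ hC hθ hξ]
  | approxEq i ζ ζ' =>
    simp only [straysTheta, straysXi, condTerms, Set.disjoint_union_right,
      Set.union_subset_iff] at hθ hξ hC
    simp only [eval, h.eval_eq ζ hC.1 hθ.1 hξ.1, h.eval_eq ζ' hC.2 hθ.2 hξ.2]
  | approxLe i ζ ζ' =>
    simp only [straysTheta, straysXi, condTerms, Set.disjoint_union_right,
      Set.union_subset_iff] at hθ hξ hC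
    simp only [eval, h.eval_eq ζ hC.1 hθ.1 hξ.1, h.eval_eq ζ' hC.2 hθ.2 hξ.2]
  | const r => rfl
  | prop X φ =>
    simp only [straysTheta, straysXi, condTerms] at hθ hξ hC
    have hφ : eval W' τ φ = eval W τ φ := funext (h.eval_eq φ hC hθ hξ)
    simp only [eval, hφ]
  | condProp X φ ψ =>
    simp only [straysTheta, straysXi, condTerms, Set.disjoint_union_right,
      Set.insert_subset_iff, Set.union_subset_iff] at hθ hξ hC
    -- In the permitted shape `‖ξ | θ ∧ χ‖` only `χ` is the same in both structures; `θ` and `ξ`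
    -- move, and the counts agree after reindexing by `π`. The recursion must skip from the whole
    -- term to `χ`, which is why it runs on size.
    by_cases hX : X = {x} ∧ φ = ξ ∧ ∃ χ, ψ = conj θ χ
    · obtain ⟨rfl, hφ, χ, rfl⟩ := hX
      obtain rfl := hφ.symm
      simp only [straysTheta, straysXi, condTerms, Set.disjoint_union_right,
        Set.union_subset_iff] at hθ hξ hC
      have hχ : eval W' τ χ = eval W τ χ := funext (h.eval_eq χ hC.2.2.2 hθ.2.2 hξ.2.2)
      have hχ' := h.cond_right χ hC.1
      refine eval_condProp_congr (count_singleton_perm π V x fun d => ?_)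
        (count_singleton_perm π V x fun d => ?_)
      · simp only [eval, hχ, hχ', h.left]
      · simp only [eval, hχ, hχ', h.left, h.right]
    · have hψ : eval W' τ ψ = eval W τ ψ := by
        refine funext (h.eval_eq ψ hC.2.2 ?_ hξ.2)
        by_cases hX' : X = {x} ∧ φ = ξ
        · rw [← straysTheta_rhs_irrelevant
            (fun χ hχ => hX ⟨hX'.1, hX'.2, χ, hχ⟩) (X = {x} ∧ φ = ξ)]
          exact hθ.2
        · simpa only [hX'] using hθ.2
      -- For `‖θ | ψ‖` the condition is unchanged and `π`-invariant, so only the numerator needs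
      -- reindexing.
      by_cases hX' : X = {x} ∧ φ = θ
      · obtain ⟨rfl, rfl⟩ := hX'
        have hψ' := h.cond_left ψ hC.1
        refine eval_condProp_congr (by rw [hψ]) (count_singleton_perm π V x fun d => ?_)
        simp only [hψ, hψ', h.left]
      · rw [if_neg hX'] at hθ
        rw [if_neg hX] at hξ
        have hφ : eval W' τ φ = eval W τ φ := funext (h.eval_eq φ hC.2.1 hθ.1 hξ.1)
        exact eval_condProp_congr (by rw [hψ]) (by rw [hφ, hψ])
  | add ζ ζ' =>
    simp only [straysTheta, straysXi, condTerms, Set.disjoint_union_right,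
      Set.union_subset_iff] at hθ hξ hC
    simp only [eval, h.eval_eq ζ hC.1 hθ.1 hξ.1, h.eval_eq ζ' hC.2 hθ.2 hξ.2]
  | mul ζ ζ' =>
    simp only [straysTheta, straysXi, condTerms, Set.disjoint_union_right,
      Set.union_subset_iff] at hθ hξ hC
    simp only [eval, h.eval_eq ζ hC.1 hθ.1 hξ.1, h.eval_eq ζ' hC.2 hθ.2 hξ.2]
termination_by sizeOf e

end Syn
end RandomWorlds

namespace RandomWorlds

variable {L : FirstOrder.Language.{u, v}}

open Syn

/-! ### Double counting -/

/-- If each `d ∈ A w` can be exchanged with the distinguished element `m w` of `A w` by an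
involution on `Ω`, then the frequency with which `T w` contains `m w` is the sum of the proportions
of `T w` in `A w`. -/
theorem sum_proportion_eq_card {α D : Type*} [DecidableEq D] (Ω : Finset α) (m : α → D)
    (A T : α → Finset D) (s : α → D → α) (hm : ∀ w ∈ Ω, m w ∈ A w)
    (hs : ∀ w ∈ Ω, ∀ d ∈ A w, s w d ∈ Ω ∧ A (s w d) = A w ∧ s (s w d) d = w ∧
      (m w ∈ T (s w d) ↔ d ∈ T w) ∧ m (s w d) = m w) :
    ∑ w ∈ Ω, ((T w ∩ A w).card : ℝ) / (A w).card = ((Ω.filter fun w => m w ∈ T w).card : ℝ) := by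
  -- Both sides become sums over pairs `(w, d)` with `d ∈ A w`, each pair weighted by `1 / |A w|`;
  -- the map `(w, d) ↦ (s w d, d)` then exchanges the two sums.
  have h₁ : ∀ w ∈ Ω, ((T w ∩ A w).card : ℝ) / (A w).card =
      ∑ d ∈ A w, (if d ∈ T w then (1 : ℝ) else 0) / (A w).card := by
    intro w _
    rw [← Finset.sum_div, Finset.sum_boole, Finset.inter_comm, Finset.filter_mem_eq_inter]
  have h₂ : ∀ w ∈ Ω, (if m w ∈ T w then (1 : ℝ) else 0) =
      ∑ _d ∈ A w, (if m w ∈ T w then (1 : ℝ) else 0) / (A w).card := by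
    intro w hw
    have : ((A w).card : ℝ) ≠ 0 := by
      exact_mod_cast (Finset.card_pos.2 ⟨_, hm w hw⟩).ne'
    rw [Finset.sum_const, nsmul_eq_mul, mul_div_cancel₀ _ this]
  rw [← Finset.sum_boole, Finset.sum_congr rfl h₁, Finset.sum_congr rfl h₂, Finset.sum_sigma',
    Finset.sum_sigma']
  have hmem : ∀ p ∈ Ω.sigma A, (⟨s p.1 p.2, p.2⟩ : Σ _ : α, D) ∈ Ω.sigma A := by
    rintro ⟨w, d⟩ hp
    obtain ⟨hw, hd⟩ := Finset.mem_sigma.1 hp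
    obtain ⟨h, hA, -⟩ := hs w hw d hd
    exact Finset.mem_sigma.2 ⟨h, by simpa only [hA] using hd⟩
  have hinv : ∀ p ∈ Ω.sigma A, (⟨s (s p.1 p.2) p.2, p.2⟩ : Σ _ : α, D) = p := by
    rintro ⟨w, d⟩ hp
    obtain ⟨hw, hd⟩ := Finset.mem_sigma.1 hp
    simp only [(hs w hw d hd).2.2.1]
  refine Finset.sum_bij' (fun p _ => ⟨s p.1 p.2, p.2⟩) (fun p _ => ⟨s p.1 p.2, p.2⟩)
    hmem hmem hinv hinv ?_
  rintro ⟨w, d⟩ hp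
  obtain ⟨hw, hd⟩ := Finset.mem_sigma.1 hp
  obtain ⟨-, hA, -, hT, hm'⟩ := hs w hw d hd
  simp only [hA, hm', hT]

theorem finite_structure [Finite L.Symbols] (M : Type) [Finite M] : Finite (L.Structure M) := by
  have : Finite (Σ l, L.Functions l) := Finite.of_injective (β := L.Symbols) _ Sum.inl_injective
  have : Finite (Σ l, L.Relations l) := Finite.of_injective (β := L.Symbols) _ Sum.inr_injective
  refine Finite.of_injective (β := ((f : Σ l, L.Functions l) → (Fin f.1 → M) → M) ×
    ((R : Σ l, L.Relations l) → (Fin R.1 → M) → Prop))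
    (fun W => (fun f => W.funMap f.2, fun R => W.RelMap R.2)) ?_
  intro W W' h
  simp only [Prod.mk.injEq] at h
  refine FirstOrder.Language.Structure.ext ?_ ?_
  · funext n f
    exact congrFun h.1 ⟨n, f⟩
  · funext n R
    exact congrFun h.2 ⟨n, R⟩

/-! ### Exchanging the constant with an element of the reference class -/

/-- Only `m` and `d` are moved, and `P` takes the same truth value at both because both lie in `P₀`.
-/
theorem swap_iff_of_uniform {M : Type} [DecidableEq M] {P₀ P : M → Prop} {m d : M} (hm : P₀ m)
    (hd : P₀ d) (h : (∀ e, P₀ e → P e) ∨ ∀ e, P₀ e → ¬ P e) (e : M) :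
    P (Equiv.swap m d e) ↔ P e := by
  have hmd : P m ↔ P d := by
    rcases h with h | h
    · exact iff_of_true (h m hm) (h d hd)
    · exact iff_of_false (h m hm) (h d hd)
  rcases eq_or_ne e m with rfl | hem
  · rw [Equiv.swap_apply_left, hmd]
  rcases eq_or_ne e d with rfl | hed
  · rw [Equiv.swap_apply_right, hmd]
  · rw [Equiv.swap_apply_of_ne_of_ne hem hed]

/-- The knowledge base decides whether the elements satisfying `φ₀(x)` satisfy `φ(x)`. -/
def Decides (KB : Formula L) (x : ℕ) (φ₀ φ : Formula L) : Prop :=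
  Entails KB (all x (imp φ₀ φ)) ∨ Entails KB (all x (imp φ₀ (neg φ)))

theorem Decides.swap_iff {KB φ₀ φ : Formula L} {x N : ℕ} (h : Decides KB x φ₀ φ)
    (hφ₀ : φ₀.freeVars ⊆ {x}) {W : L.Structure (Fin N)} {τ : ℕ → ℝ} (hτ : τ ∈ Tolerances)
    (hW : ∀ V, KB.eval W τ V) {m d : Fin N} (hm : φ₀.eval W τ fun _ => m)
    (hd : φ₀.eval W τ fun _ => d) (V : ℕ → Fin N) (e : Fin N) :
    eval W τ φ (Function.update V x (Equiv.swap m d e)) ↔ eval W τ φ (Function.update V x e) := by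
  have h₀ : ∀ e, eval W τ φ₀ (Function.update V x e) = eval W τ φ₀ fun _ => e := fun e =>
    eval_update W τ hφ₀ (by simp)
  refine swap_iff_of_uniform (P₀ := fun e => eval W τ φ₀ fun _ => e)
    (P := fun e => eval W τ φ (Function.update V x e)) hm hd ?_ e
  refine h.imp (fun h e he => ?_) (fun h e he => ?_)
  · have := h N W V τ hτ (hW V) e
    rw [eval_imp] at this
    exact this ((Eq.to_iff (h₀ e)).2 he)
  · have := h N W V τ hτ (hW V) e
    rw [eval_imp] at this
    exact this ((Eq.to_iff (h₀ e)).2 he)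

theorem movedBy_permuteOn {KB φ₀ θ ξ : Formula L} {x N : ℕ} (hφ₀ : φ₀.freeVars ⊆ {x})
    (hθ : θ.freeVars ⊆ {x}) (hξ : ξ.freeVars ⊆ {x})
    (hl : ∀ φ, ({x}, θ, φ) ∈ KB.condTerms → Decides KB x φ₀ φ)
    (hr : ∀ ψ, ({x}, ξ, conj θ ψ) ∈ KB.condTerms → Decides KB x φ₀ ψ)
    {W : L.Structure (Fin N)} {τ : ℕ → ℝ} (hτ : τ ∈ Tolerances)
    (hW : ∀ V, KB.eval W τ V) {m d : Fin N} (hm : φ₀.eval W τ fun _ => m)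
    (hd : φ₀.eval W τ fun _ => d) :
    MovedBy W (permuteOn (θ.symbols ∪ ξ.symbols) (Equiv.swap m d) W) τ (Equiv.swap m d) x θ ξ
      KB.condTerms := by
  -- Isomorphism moves the whole valuation by the transposition; since `η` sees only `x`, the other
  -- coordinates may be restored.
  have key : ∀ η : Formula L, η.freeVars ⊆ {x} → η.symbols ⊆ θ.symbols ∪ ξ.symbols → ∀ V e,
      eval (permuteOn (θ.symbols ∪ ξ.symbols) (Equiv.swap m d) W) τ η
        (Function.update V x (Equiv.swap m d e)) ↔ eval W τ η (Function.update V x e) := by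
    intro η hη hS V e
    rw [← (matchedOn_permuteOn _ (Equiv.swap m d) W).eval τ η hS,
      eval_update _ τ hη]
    simp
  exact
  { matched := matchedOn_permuteOn_compl _ _ W
    left := key θ hθ Set.subset_union_left
    right := key ξ hξ Set.subset_union_right
    cond_left := fun φ hφ => (hl φ hφ).swap_iff hφ₀ hτ hW hm hd
    cond_right := fun ψ hψ => (hr ψ hψ).swap_iff hφ₀ hτ hW hm hd }

open Classical in
/-- The set of elements satisfying `φ`, for a formula with at most one free variable. -/
noncomputable def extension {N : ℕ} (τ : ℕ → ℝ) (φ : Formula L) (W : L.Structure (Fin N)) :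
    Finset (Fin N) := Finset.univ.filter fun d => φ.eval W τ fun _ => d

theorem mem_extension {N : ℕ} {τ : ℕ → ℝ} {φ : Formula L} {W : L.Structure (Fin N)} {d : Fin N} :
    d ∈ extension τ φ W ↔ φ.eval W τ fun _ => d := by
  simp [extension]

theorem eval_inst_iff_mem_extension {N : ℕ} {τ : ℕ → ℝ} {φ : Formula L} {x : ℕ}
    (hφ : φ.freeVars ⊆ {x}) {W : L.Structure (Fin N)} {c : L.Constants} {V : ℕ → Fin N} :
    eval W τ (inst x c φ) V ↔ constVal W c ∈ extension τ φ W := by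
  rw [eval_inst, mem_extension, eval_update W τ hφ]
  simp

theorem eval_condProp_eq {N : ℕ} {τ : ℕ → ℝ} {φ ψ : Formula L} {x : ℕ}
    (hφ : φ.freeVars ⊆ {x}) (hψ : ψ.freeVars ⊆ {x}) {W : L.Structure (Fin N)} (V : ℕ → Fin N)
    (h : (extension τ ψ W).Nonempty) :
    eval W τ (condProp {x} φ ψ) V =
      some (((extension τ φ W ∩ extension τ ψ W).card : ℝ) / (extension τ ψ W).card) := by
  have e : ∀ {η : Formula L}, η.freeVars ⊆ {x} → ∀ d,
      eval W τ η (Function.update V x d) ↔ d ∈ extension τ η W := fun hη d => by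
    rw [mem_extension, eval_update W τ hη]
    simp
  have hc : ∀ (P : (ℕ → Fin N) → Prop) (F : Finset (Fin N)),
      (∀ d, P (Function.update V x d) ↔ d ∈ F) → count V {x} P = F.card := fun P F hP => by
    rw [count_singleton, Nat.card_congr (Equiv.subtypeEquivRight hP), Nat.card_eq_fintype_card,
      Fintype.card_coe]
  simp only [eval]
  rw [hc (eval W τ ψ) _ (e hψ), if_neg (Finset.card_pos.2 h).ne',
    hc _ (extension τ φ W ∩ extension τ ψ W) fun d => by rw [e hφ, e hψ, Finset.mem_inter]]

end RandomWorlds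

namespace RandomWorlds

variable {L : FirstOrder.Language.{u, v}}

open Syn

/-! ### Direct inference -/

/-- The knowledge base `φ₀(c) ∧ (a ⪯ᵢ ‖θ(x) | φ₀(x)‖_x ⪯ⱼ b) ∧ KB''`. -/
def statKB (x : ℕ) (c : L.Constants) (φ₀ θ KB'' : Formula L) (a b : ℝ) (i j : ℕ) : Formula L :=
  conj (conj (φ₀.inst x c)
    (conj (approxLe i (const a) (condProp {x} θ φ₀))
      (approxLe j (condProp {x} θ φ₀) (const b)))) KB''

/-- The proportion of `θ` in the reference class `φ₀`. -/
noncomputable def proportion {N : ℕ} (τ : ℕ → ℝ) (θ φ₀ : Formula L) (W : L.Structure (Fin N)) :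
    ℝ :=
  ((extension τ θ W ∩ extension τ φ₀ W).card : ℝ) / (extension τ φ₀ W).card

section

variable {x : ℕ} {c : L.Constants} {φ₀ θ ξ KB'' : Formula L} {a b : ℝ} {i j : ℕ}

theorem constVal_mem_extension (hφ₀ : φ₀.freeVars ⊆ {x}) {N : ℕ} {τ : ℕ → ℝ}
    {W : L.Structure (Fin N)} (hW : ∀ V, (statKB x c φ₀ θ KB'' a b i j).eval W τ V) :
    constVal W c ∈ extension τ φ₀ W := by
  have h := hW fun _ => constVal W c
  simp only [statKB, eval] at h
  exact (eval_inst_iff_mem_extension hφ₀).1 h.1.1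

/-- The denotation of `c` witnesses that the reference class is nonempty, so the two comparisons are
not vacuous. -/
theorem proportion_bounds (hφ₀ : φ₀.freeVars ⊆ {x}) (hθ : θ.freeVars ⊆ {x}) {N : ℕ}
    {τ : ℕ → ℝ} {W : L.Structure (Fin N)}
    (hW : ∀ V, (statKB x c φ₀ θ KB'' a b i j).eval W τ V) :
    a - τ i ≤ proportion τ θ φ₀ W ∧ proportion τ θ φ₀ W ≤ b + τ j := by
  have h : (statKB x c φ₀ θ KB'' a b i j).eval W τ fun _ => constVal W c := hW _
  have hcond := eval_condProp_eq hθ hφ₀ (fun _ => constVal W c)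
    ⟨_, constVal_mem_extension hφ₀ hW⟩
  obtain ⟨⟨-, h₁, h₂⟩, -⟩ := h
  have h₁' := h₁ a rfl _ hcond
  have h₂' := h₂ _ hcond b rfl
  exact ⟨sub_le_iff_le_add.2 h₁', h₂'⟩

theorem constVal_permuteOn {M : Type} {S : Set L.Symbols} (hc : Sum.inl ⟨0, c⟩ ∉ S)
    (π : Equiv.Perm M) (W : L.Structure M) : constVal (permuteOn S π W) c = constVal W c := by
  have h := (matchedOn_permuteOn_compl S π W).fun_eq c default hc
  simp only [constVal]
  rw [Subsingleton.elim default (Equiv.refl M ∘ default)]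
  exact h

/-- The averaging identity: the exchange of `c` with members of its class meets the requirements of
`sum_proportion_eq_card`. -/
theorem sum_proportion_eq [Finite L.Symbols] (hφ₀ : φ₀.freeVars ⊆ {x})
    (hθ : θ.freeVars ⊆ {x}) (hξ : ξ.freeVars ⊆ {x}) (hcθ : Sum.inl ⟨0, c⟩ ∉ θ.symbols)
    (hcξ : Sum.inl ⟨0, c⟩ ∉ ξ.symbols) {KB : Formula L}
    (hKB : KB = statKB x c φ₀ θ KB'' a b i j)
    (hl : ∀ φ, ({x}, θ, φ) ∈ KB.condTerms → Decides KB x φ₀ φ)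
    (hr : ∀ ψ, ({x}, ξ, conj θ ψ) ∈ KB.condTerms → Decides KB x φ₀ ψ)
    (hsθ : Disjoint θ.symbols (straysTheta x θ ξ False KB))
    (hsξ : Disjoint ξ.symbols (straysXi x θ ξ KB)) {N : ℕ} {τ : ℕ → ℝ} (hτ : τ ∈ Tolerances)
    (Ω : Finset (L.Structure (Fin N))) (hΩ : ∀ W, W ∈ Ω ↔ ∀ V, KB.eval W τ V) :
    ∑ W ∈ Ω, proportion τ θ φ₀ W =
      ((Ω.filter fun W => constVal W c ∈ extension τ θ W).card : ℝ) := by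
  have hmem : ∀ W ∈ Ω, constVal W c ∈ extension τ φ₀ W := fun W hW =>
    constVal_mem_extension hφ₀ (hKB ▸ (hΩ W).1 hW)
  -- In this degenerate case `‖θ | φ₀‖` also has the form `‖ξ | θ ∧ χ‖`, so symbols of `θ` are
  -- permitted inside `φ₀` and the class may move. But then `φ₀` implies `θ`: every proportion is
  -- `1` and `c` always satisfies `θ`.
  by_cases hdeg : θ = ξ ∧ ∃ χ, φ₀ = conj θ χ
  · obtain ⟨-, χ, rfl⟩ := hdeg
    have hsub : ∀ W : L.Structure (Fin N), extension τ (conj θ χ) W ⊆ extension τ θ W :=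
      fun W d hd => mem_extension.2 (mem_extension.1 hd).1
    rw [Finset.filter_true_of_mem fun W hW => hsub W (hmem W hW), Finset.card_eq_sum_ones,
      Nat.cast_sum]
    refine Finset.sum_congr rfl fun W hW => ?_
    have h0 : ((extension τ (conj θ χ) W).card : ℝ) ≠ 0 := by
      exact_mod_cast (Finset.card_pos.2 ⟨_, hmem W hW⟩).ne'
    rw [proportion, Finset.inter_eq_right.2 (hsub W), div_self h0, Nat.cast_one]
  -- Otherwise the occurrence of `φ₀` as a condition inside `KB` shows that `φ₀` has no symbols of
  -- `θ` or `ξ` outside permitted places, so its extension is preserved.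
  · have hinv : ∀ {W W' : L.Structure (Fin N)} {π : Equiv.Perm (Fin N)},
        MovedBy W W' τ π x θ ξ KB.condTerms → ∀ V, eval W' τ φ₀ V = eval W τ φ₀ V := by
      intro W W' π h
      have hC : φ₀.condTerms ⊆ KB.condTerms := by
        rw [hKB]
        intro t ht
        simp only [statKB, condTerms]
        simp [ht]
      have hsθ' := hsθ
      have hsξ' := hsξ
      simp only [hKB, statKB, straysTheta, straysXi, Set.disjoint_union_right, false_and,
        if_false, true_and] at hsθ' hsξ'
      refine h.eval_eq φ₀ hC ?_ hsξ'.1.2.1.2.2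
      have hφ₀' := hsθ'.1.2.1.2.2
      by_cases he : θ = ξ
      · rwa [straysTheta_rhs_irrelevant (fun χ hχ => hdeg ⟨he, χ, hχ⟩)] at hφ₀'
      · simpa only [he] using hφ₀'
    refine sum_proportion_eq_card Ω (fun W => constVal W c) (extension τ φ₀) (extension τ θ)
      (fun W d => permuteOn (θ.symbols ∪ ξ.symbols) (Equiv.swap (constVal W c) d) W) hmem ?_
    intro W hW d hd
    have hmv := movedBy_permuteOn hφ₀ hθ hξ hl hr hτ ((hΩ W).1 hW)
      (mem_extension.1 (hmem W hW)) (mem_extension.1 hd)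
    have hcW : constVal (permuteOn (θ.symbols ∪ ξ.symbols) (Equiv.swap (constVal W c) d) W) c =
        constVal W c := constVal_permuteOn (by simp [hcθ, hcξ]) _ W
    refine ⟨(hΩ _).2 fun V => ?_, ?_, ?_, ?_, hcW⟩
    · exact (Eq.to_iff (hmv.eval_eq KB subset_rfl hsθ hsξ V)).2 ((hΩ W).1 hW V)
    · ext e
      rw [mem_extension, mem_extension, hinv hmv]
    · simp only [hcW]
      exact permuteOn_swap_swap _ _ _ W
    · have h := hmv.left (fun _ => d) d
      rw [Equiv.swap_apply_right, eval_update _ τ hθ (V' := fun _ => constVal W c) (by simp),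
        eval_update W τ hθ (V' := fun _ => d) (by simp)] at h
      rw [mem_extension, mem_extension]
      exact h

theorem Pr_bounds [Finite L.Symbols] (hφ₀ : φ₀.freeVars ⊆ {x})
    (hθ : θ.freeVars ⊆ {x}) (hξ : ξ.freeVars ⊆ {x}) (hcθ : Sum.inl ⟨0, c⟩ ∉ θ.symbols)
    (hcξ : Sum.inl ⟨0, c⟩ ∉ ξ.symbols) {KB : Formula L}
    (hKB : KB = statKB x c φ₀ θ KB'' a b i j)
    (hl : ∀ φ, ({x}, θ, φ) ∈ KB.condTerms → Decides KB x φ₀ φ)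
    (hr : ∀ ψ, ({x}, ξ, conj θ ψ) ∈ KB.condTerms → Decides KB x φ₀ ψ)
    (hsθ : Disjoint θ.symbols (straysTheta x θ ξ False KB))
    (hsξ : Disjoint ξ.symbols (straysXi x θ ξ KB)) {N : ℕ} {τ : ℕ → ℝ} (hτ : τ ∈ Tolerances)
    (hpos : 0 < numWorlds N τ KB) :
    a - τ i ≤ Pr N τ (θ.inst x c) KB ∧ Pr N τ (θ.inst x c) KB ≤ b + τ j := by
  classical
  have := finite_structure (L := L) (Fin N)
  let _ := Fintype.ofFinite (L.Structure (Fin N))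
  set Ω : Finset (L.Structure (Fin N)) := Finset.univ.filter fun W => ∀ V, KB.eval W τ V with hΩ'
  have hΩ : ∀ W, W ∈ Ω ↔ ∀ V, KB.eval W τ V := fun W => by simp [hΩ']
  have hn : numWorlds N τ KB = Ω.card := by
    rw [numWorlds, Nat.card_eq_fintype_card, Fintype.card_subtype]
  have hn' : numWorlds N τ (conj (θ.inst x c) KB) =
      (Ω.filter fun W => constVal W c ∈ extension τ θ W).card := by
    rw [numWorlds, Nat.card_eq_fintype_card, Fintype.card_subtype, hΩ', Finset.filter_filter]
    congr 1
    refine Finset.filter_congr fun W _ => ?_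
    simp only [eval, eval_inst_iff_mem_extension hθ]
    -- Dropping the quantifier over valuations needs one valuation to exist; `c` provides a domain
    -- element.
    exact ⟨fun h => ⟨fun V => (h V).2, (h fun _ => constVal W c).1⟩,
      fun h V => ⟨h.2, h.1 V⟩⟩
  have hsum := sum_proportion_eq hφ₀ hθ hξ hcθ hcξ hKB hl hr hsθ hsξ hτ Ω hΩ
  have hb : ∀ W ∈ Ω, a - τ i ≤ proportion τ θ φ₀ W ∧ proportion τ θ φ₀ W ≤ b + τ j :=
    fun W hW => proportion_bounds hφ₀ hθ (hKB ▸ (hΩ W).1 hW)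
  have hlow := Finset.card_nsmul_le_sum Ω _ _ fun W hW => (hb W hW).1
  have hupp := Finset.sum_le_card_nsmul Ω _ _ fun W hW => (hb W hW).2
  have hcard : (0 : ℝ) < Ω.card := by exact_mod_cast hn ▸ hpos
  rw [nsmul_eq_mul, hsum] at hlow hupp
  rw [Pr, hn, hn', le_div_iff₀ hcard, div_le_iff₀ hcard]
  exact ⟨by linarith, by linarith⟩

end

/-! ### Passage to the limit -/

/-- The constant vectors `1 / (n + 1)` are positive and tend to `0`. Without this, limits along
`toZero` would carry no information. -/
instance toZero_neBot : toZero.NeBot := by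
  have ht : Tendsto (fun n : ℕ => fun _ : ℕ => 1 / ((n : ℝ) + 1)) atTop toZero := by
    refine tendsto_nhdsWithin_iff.2 ⟨tendsto_pi_nhds.2 fun _ =>
      tendsto_one_div_add_atTop_nhds_zero_nat, Eventually.of_forall fun n _ => ?_⟩
    positivity
  exact ht.neBot

theorem tendsto_apply_toZero (i : ℕ) : Tendsto (fun τ : ℕ → ℝ => τ i) toZero (𝓝 0) :=
  ((continuous_apply i).tendsto (0 : ℕ → ℝ)).mono_left nhdsWithin_le_nhds

/-- Bounds on the finite probabilities that become tight for small tolerances bound the degree of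
belief. -/
theorem HasDegreeOfBelief.mem_Icc {φ KB : Formula L} {a b p : ℝ} {i j : ℕ}
    (h : HasDegreeOfBelief φ KB p)
    (hb : ∀ τ ∈ Tolerances, ∀ N, 0 < numWorlds N τ KB →
      a - τ i ≤ Pr N τ φ KB ∧ Pr N τ φ KB ≤ b + τ j) : p ∈ Set.Icc a b := by
  obtain ⟨hcons, hinf, hsup⟩ := h
  have hτ : ∀ᶠ τ in toZero, τ ∈ Tolerances := self_mem_nhdsWithin
  have hbd : ∀ᶠ τ in toZero, ∀ᶠ N in atTop, a - τ i ≤ Pr N τ φ KB ∧ Pr N τ φ KB ≤ b + τ j := by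
    filter_upwards [hτ, hcons] with τ hτ hN
    exact hN.mono fun N hN => hb τ hτ N hN
  have hlow : Tendsto (fun τ : ℕ → ℝ => a - τ i) toZero (𝓝 a) := by
    simpa using (tendsto_apply_toZero i).const_sub a
  have hupp : Tendsto (fun τ : ℕ → ℝ => b + τ j) toZero (𝓝 b) := by
    simpa using (tendsto_apply_toZero j).const_add b
  refine ⟨le_of_tendsto_of_tendsto hlow hinf ?_, le_of_tendsto_of_tendsto hsup hupp ?_⟩
  · filter_upwards [hbd] with τ h
    -- For real sequences, comparing with the liminf also needs a bound from the opposite side; the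
    -- other half of the estimate gives it.
    exact le_liminf_of_le (IsBoundedUnder.isCoboundedUnder_ge ⟨b + τ j, eventually_map.2 (h.mono fun N h => h.2)⟩)
      (h.mono fun N h => h.1)
  · filter_upwards [hbd] with τ h
    exact limsup_le_of_le (IsBoundedUnder.isCoboundedUnder_le ⟨a - τ i, eventually_map.2 (h.mono fun N h => h.1)⟩)
      (h.mono fun N h => h.2)

end RandomWorlds

open RandomWorlds RandomWorlds.Syn in
theorem mainTheorem4 {L : FirstOrder.Language.{u, v}} [Finite L.Symbols]
    (x : ℕ) (c : L.Constants) (φ₀ θ ξ KB'' KB : Formula L) (a b : ℝ) (i j : ℕ)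
    (hφ₀ : φ₀.freeVars ⊆ {x}) (hθ : θ.freeVars ⊆ {x}) (hξ : ξ.freeVars ⊆ {x})
    (hKB'' : KB''.freeVars = ∅)
    -- the constant `c` occurs in neither `θ` nor `ξ`
    (hcθ : Sum.inl ⟨0, c⟩ ∉ θ.symbols) (hcξ : Sum.inl ⟨0, c⟩ ∉ ξ.symbols)
    -- `KB = (φ₀(c) ∧ (a ⪯ᵢ ‖θ(x) | φ₀(x)‖_x ∧ ‖θ(x) | φ₀(x)‖_x ⪯ⱼ b)) ∧ KB''`
    (hKB : KB = conj (conj (φ₀.inst x c)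
      (conj (approxLe i (const a) (condProp {x} θ φ₀))
        (approxLe j (condProp {x} θ φ₀) (const b)))) KB'')
    -- `ξ` logically implies `θ`
    (h2 : Entails KB (all x (imp ξ θ)))
    -- on every `‖θ(x) | φ(x)‖_x` in `KB`
    (h3 : ∀ φ, ({x}, θ, φ) ∈ KB.condTerms →
      Entails KB (all x (imp φ₀ φ)) ∨ Entails KB (all x (imp φ₀ (neg φ))))
    -- on every `‖ξ(x) | θ(x) ∧ ψ(x)‖_x` in `KB`
    (h4 : ∀ ψ, ({x}, ξ, conj θ ψ) ∈ KB.condTerms →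
      Entails KB (all x (imp φ₀ ψ)) ∨ Entails KB (all x (imp φ₀ (neg ψ))))
    -- the symbols of `θ` appear in `KB` only in the permitted places
    (h5 : Disjoint θ.symbols (straysTheta x θ ξ False KB))
    -- the symbols of `ξ` appear in `KB` only in the permitted places
    (h6 : Disjoint ξ.symbols (straysXi x θ ξ KB)) :
    ∀ p : ℝ, HasDegreeOfBelief (θ.inst x c) KB p → p ∈ Set.Icc a b := by
  intro p hp
  exact hp.mem_Icc fun τ hτ N hN => Pr_bounds hφ₀ hθ hξ hcθ hcξ hKB h3 h4 h5 h6 hτ hN
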